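/- Let $n\ge 1$ and $1\le k\le m$ be integers, let $[m]=\{1,\dots,m\}$, and let $\mathcal C_k$ denote the collection of all subsets of $[m]$ of cardinality $k$. Let $A$ and $B_1,\dots,B_m$ be convex bodies in $\mathbb R^n$, that is, compact convex sets with nonempty interior. Write $|\cdot|$ for $n$-dimensional Lebesgue measure (volume) and $+$, $\sum$ for Minkowski sums of sets. Suppose that real numbers $c_s$, $s\in\mathcal C_k$, are given such that $$\Big|A+\sum_{i\in s}B_i\Big|^{1/n}\le c_s\,|A|^{1/n}\qquad\text{for every } s\in\mathcal C_k .$$ Then $$\Big|A+\sum_{i\in[m]}B_i\Big|^{1/n}\le (1+m)\Big[\prod_{s\in\mathcal C_k}c_s\Big]^{1/\binom{m-1}{k-1}}\,|A|^{1/n}.$$ -/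

import Mathlib

open MeasureTheory

open scoped Pointwise

/-! ### Petridis's argument for sums with a finite set. -/

section Petridis

variable {E : Type*} [NormedAddCommGroup E] [MeasurableSpace E]
  (μ : Measure E) [μ.IsAddHaarMeasure]

/-! The logarithm F(s) of the volume of A + ∑_{i ∈ s} B_i is almost submodular: for T ⊆ S and I
disjoint from S, F(S ∪ I) is at most F(S) plus the marginals of i ∈ I at T, plus n log(1 + |I|)
(`log_measureReal_add_sum_union_le`). This rests on the Plünnecke-type inequality |A||D + C| ≤ |A +
C||A + D| for convex bodies (`measureReal_mul_add_le`), obtained by Petridis's method for finite D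
and then by approximation. Averaging over random orderings of the indices, with S the first k and T
the first j < k, telescopes the marginals (`choose_mul_sub_le_sum_powersetCard`). The additive loss
n log(1 + m) becomes the factor 1 + m after taking n-th roots. -/

theorem measureReal_vadd_add_eq (x : E) (s : Set E) : μ.real ((fun y => x + y) '' s) = μ.real s := by
  rw [measureReal_def, measureReal_def, ← measure_vadd μ x s]
  rfl

theorem measureReal_le_add_of_nonempty {s t : Set E} (hs : s.Nonempty) (hst : IsCompact (s + t)) :
    μ.real t ≤ μ.real (s + t) := by
  obtain ⟨x, hx⟩ := hs
  rw [← measureReal_vadd_add_eq μ x t]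
  refine measureReal_mono ?_ hst.measure_lt_top.ne
  rintro _ ⟨y, hy, rfl⟩
  exact Set.add_mem_add hx hy

variable [BorelSpace E]

/-- The infimum of |X + C| / |X| over compact sets need not be attained, so the induction on F works
with a near-minimizer and pays ε per translate. -/
theorem measureReal_add_finset_le_of_near_minimizer {X C : Set E} (hX : IsCompact X)
    (hC : IsCompact C) {γ ε : ℝ} (hγ : 0 ≤ γ)
    (hε : μ.real (X + C) ≤ γ * μ.real X + ε)
    (hmin : ∀ Z ⊆ X, IsCompact Z → γ * μ.real Z ≤ μ.real (Z + C)) (F : Finset E) :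
    μ.real ((X + C) + F) ≤ γ * μ.real (X + F) + F.card * ε := by
  classical
  induction F using Finset.induction_on with
  | empty => simp
  | insert e F he ih =>
    have hF : IsCompact (F : Set E) := F.finite_toSet.isCompact
    have hXCF : IsCompact (X + C + (F : Set E)) := (hX.add hC).add hF
    have hXF : IsCompact (X + (F : Set E)) := hX.add hF
    set τ : E → E := fun y => e + y with hτ
    have hτc : Continuous τ := by fun_prop
    have hτi : Function.Injective τ := add_right_injective e
    have split : ∀ Y : Set E, Y + ((insert e F : Finset E) : Set E) = (Y + F) ∪ τ '' Y := by
      intro Y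
      rw [Finset.coe_insert, ← Set.union_singleton, Set.add_union, Set.add_singleton]
      simp [hτ, add_comm]
    -- Points whose translate of C by e is already covered: Z + C adds nothing new, and |Z + C| is
    -- bounded below by minimality.
    set Z : Set E := X ∩ ⋂ c ∈ C, (fun x => τ (x + c)) ⁻¹' (X + C + F) with hZ
    have hZX : Z ⊆ X := Set.inter_subset_left
    have hZc : IsCompact Z := by
      refine hX.inter_right (isClosed_biInter fun c _ => hXCF.isClosed.preimage ?_)
      fun_prop
    have hZC : IsCompact (Z + C) := hZc.add hC
    have hZCF : τ '' (Z + C) ⊆ X + C + F := by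
      rintro _ ⟨_, ⟨x, hx, c, hc, rfl⟩, rfl⟩
      exact Set.mem_iInter₂.1 hx.2 c hc
    set W : Set E := X ∩ τ ⁻¹' (X + F) with hW
    have hWc : IsCompact W := hX.inter_right (hXF.isClosed.preimage hτc)
    have hWZ : W ⊆ Z := by
      rintro x ⟨hx, hx'⟩
      refine ⟨hx, Set.mem_iInter₂.2 fun c hc => ?_⟩
      obtain ⟨y, hy, f, hf, hyf⟩ := hx'
      refine ⟨y + c, Set.add_mem_add hy hc, f, hf, ?_⟩
      simp only [hτ] at hyf ⊢
      rw [← add_assoc, ← hyf]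
      abel
    have upper : μ.real (X + C + F ∪ τ '' (X + C)) ≤
        μ.real (X + C + F) + (μ.real (X + C) - μ.real (Z + C)) := by
      have h1 : X + C + F ∪ τ '' (X + C) ⊆ (X + C + F) ∪ τ '' ((X + C) \ (Z + C)) := by
        rintro y (hy | ⟨x, hx, rfl⟩)
        · exact Or.inl hy
        · by_cases hxz : x ∈ Z + C
          · exact Or.inl (hZCF ⟨x, hxz, rfl⟩)
          · exact Or.inr ⟨x, ⟨hx, hxz⟩, rfl⟩
      have hfin : μ (τ '' ((X + C) \ (Z + C))) ≠ ⊤ :=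
        ((measure_mono (Set.image_mono Set.sdiff_subset)).trans_lt
          ((hX.add hC).image hτc).measure_lt_top).ne
      calc _ ≤ μ.real ((X + C + F) ∪ τ '' ((X + C) \ (Z + C))) :=
            measureReal_mono h1 (measure_union_lt_top hXCF.measure_lt_top hfin.lt_top).ne
        _ ≤ μ.real (X + C + F) + μ.real (τ '' ((X + C) \ (Z + C))) := measureReal_union_le _ _
        _ = _ := by
          rw [measureReal_vadd_add_eq, measureReal_sdiff (Set.add_subset_add_right hZX)
            hZC.measurableSet (hX.add hC).measure_lt_top.ne]
    have lower : μ.real (X + F) + (μ.real X - μ.real W) ≤ μ.real (X + F ∪ τ '' X) := by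
      have h1 : (X + F) ∪ τ '' (X \ W) ⊆ X + F ∪ τ '' X :=
        Set.union_subset_union_right _ (Set.image_mono Set.sdiff_subset)
      have hdisj : Disjoint (τ '' (X \ W)) (X + (F : Set E)) := by
        rw [Set.disjoint_left]
        rintro _ ⟨x, ⟨hx, hxW⟩, rfl⟩ h
        exact hxW ⟨hx, h⟩
      have hfin : μ (τ '' (X \ W)) ≠ ⊤ :=
        ((measure_mono (Set.image_mono Set.sdiff_subset)).trans_lt
          (hX.image hτc).measure_lt_top).ne
      calc _ = μ.real (X + F) + μ.real (τ '' (X \ W)) := by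
            rw [measureReal_vadd_add_eq, measureReal_sdiff Set.inter_subset_left
              hWc.measurableSet hX.measure_lt_top.ne]
        _ = μ.real ((X + F) ∪ τ '' (X \ W)) := by
            rw [Set.union_comm, measureReal_union hdisj hXF.measurableSet hfin
              hXF.measure_lt_top.ne, add_comm]
        _ ≤ _ := measureReal_mono h1
            (measure_union_lt_top hXF.measure_lt_top (hX.image hτc).measure_lt_top).ne
    have hWZ' : μ.real W ≤ μ.real Z := measureReal_mono hWZ hZc.measure_lt_top.ne
    have hZmin := hmin Z hZX hZc
    rw [split, split, Finset.card_insert_of_notMem he]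
    push_cast
    nlinarith [mul_le_mul_of_nonneg_left lower hγ, mul_le_mul_of_nonneg_left hWZ' hγ]

theorem measureReal_mul_add_finset_le {A C : Set E} (hA : IsCompact A) (hC : IsCompact C)
    (hA0 : 0 < μ.real A) (F : Finset E) :
    μ.real A * μ.real (C + F) ≤ μ.real (A + C) * μ.real (A + F) := by
  have hF : IsCompact (F : Set E) := F.finite_toSet.isCompact
  set R : Set ℝ := {r | ∃ X ⊆ A, IsCompact X ∧ 0 < μ.real X ∧ r = μ.real (X + C) / μ.real X} with hR
  have hRA : μ.real (A + C) / μ.real A ∈ R := ⟨A, subset_rfl, hA, hA0, rfl⟩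
  have hR0 : ∀ r ∈ R, 0 ≤ r := by
    rintro r ⟨X, -, -, -, rfl⟩
    positivity
  have hRb : BddBelow R := ⟨0, hR0⟩
  set γ := sInf R with hγ
  have hγ0 : 0 ≤ γ := Real.sInf_nonneg hR0
  have hγA : γ ≤ μ.real (A + C) / μ.real A := csInf_le hRb hRA
  have key : ∀ ε > 0, μ.real (C + F) ≤ γ * μ.real (A + F) + ε * (F.card * μ.real A) := by
    intro ε hε
    obtain ⟨_, ⟨X, hXA, hX, hX0, rfl⟩, hlt⟩ := exists_lt_of_csInf_lt ⟨_, hRA⟩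
      (show sInf R < γ + ε by linarith)
    have hmin : ∀ Z ⊆ X, IsCompact Z → γ * μ.real Z ≤ μ.real (Z + C) := by
      intro Z hZX hZ
      rcases (measureReal_nonneg : 0 ≤ μ.real Z).eq_or_lt with h0 | h0
      · rw [← h0, mul_zero]
        exact measureReal_nonneg
      · exact (le_div_iff₀ h0).1 (csInf_le hRb ⟨Z, hZX.trans hXA, hZ, h0, rfl⟩)
    have hnear : μ.real (X + C) ≤ γ * μ.real X + ε * μ.real X := by
      rw [← add_mul]
      exact ((div_lt_iff₀ hX0).1 hlt).le
    have hXne : X.Nonempty := by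
      by_contra h
      rw [Set.not_nonempty_iff_eq_empty.1 h] at hX0
      simp at hX0
    have h1 := measureReal_add_finset_le_of_near_minimizer μ hX hC hγ0 hnear hmin F
    have h2 : μ.real (C + F) ≤ μ.real (X + C + F) := by
      rw [add_assoc]
      exact measureReal_le_add_of_nonempty μ hXne (hX.add (hC.add hF))
    have h3 : μ.real (X + F) ≤ μ.real (A + F) :=
      measureReal_mono (Set.add_subset_add_right hXA) (hA.add hF).measure_lt_top.ne
    have h4 : μ.real X ≤ μ.real A := measureReal_mono hXA hA.measure_lt_top.ne
    calc _ ≤ _ := h2.trans h1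
      _ ≤ γ * μ.real (A + F) + F.card * (ε * μ.real A) := by gcongr
      _ = _ := by ring
  have hle : μ.real (C + F) ≤ γ * μ.real (A + F) := by
    refine le_of_forall_pos_le_add fun δ hδ => ?_
    -- The added 1 keeps the denominator positive when F is empty.
    have hp : 0 < F.card * μ.real A + 1 := by positivity
    refine (key (δ / (F.card * μ.real A + 1)) (by positivity)).trans ?_
    gcongr
    rw [div_mul_eq_mul_div, div_le_iff₀ hp]
    nlinarith
  calc μ.real A * μ.real (C + F) ≤ μ.real A * (γ * μ.real (A + F)) := by gcongr
    _ = (γ * μ.real A) * μ.real (A + F) := by ring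
    _ ≤ μ.real (A + C) * μ.real (A + F) := by
      gcongr
      exact (le_div_iff₀ hA0).1 hγA

end Petridis

/-! ### Almost submodularity of log volume for convex bodies. -/

section ConvexBodies

variable {E : Type*} [NormedAddCommGroup E] [NormedSpace ℝ E]

/-- A compact convex set with nonempty interior. -/
structure IsSolid (s : Set E) : Prop where
  convex : Convex ℝ s
  isCompact : IsCompact s
  nonempty_interior : (interior s).Nonempty

namespace IsSolid

variable {s t : Set E}

theorem nonempty (hs : IsSolid s) : s.Nonempty := hs.nonempty_interior.mono interior_subset

theorem add (hs : IsSolid s) (ht : IsSolid t) : IsSolid (s + t) where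
  convex := hs.convex.add ht.convex
  isCompact := hs.isCompact.add ht.isCompact
  nonempty_interior := (hs.nonempty_interior.add ht.nonempty).mono subset_interior_add_left

theorem add_sum {ι : Type*} {B : ι → Set E} (hB : ∀ i, IsSolid (B i)) (hs : IsSolid s)
    (I : Finset ι) : IsSolid (s + ∑ i ∈ I, B i) := by
  classical
  induction I using Finset.induction_on with
  | empty => simpa
  | insert i I hi ih =>
    rw [Finset.sum_insert hi, add_left_comm]
    exact (hB i).add ih

theorem measureReal_pos [MeasurableSpace E] (μ : Measure E) [μ.IsAddHaarMeasure]
    (hs : IsSolid s) : 0 < μ.real s :=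
  ENNReal.toReal_pos (Measure.measure_pos_of_nonempty_interior μ hs.nonempty_interior).ne'
    hs.isCompact.measure_lt_top.ne

end IsSolid

variable [FiniteDimensional ℝ E] [MeasurableSpace E] [BorelSpace E] (μ : Measure E)
  [μ.IsAddHaarMeasure]

/-- Compact subsets of the open set D + int C are covered by finitely many translates of C by points
of D, which reduces to the finite case. Passing to int C costs no volume, since a convex set has
null frontier. -/
theorem measureReal_mul_add_le {A C D : Set E} (hA : IsSolid A) (hC : IsSolid C) (hD : IsSolid D) :
    μ.real A * μ.real (D + C) ≤ μ.real (A + C) * μ.real (A + D) := by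
  have hA0 := hA.measureReal_pos μ
  have hU : IsOpen (D + interior C) := isOpen_interior.add_left
  have hsub : D + interior C ⊆ D + C := Set.add_subset_add_left interior_subset
  have hDC : IsCompact (D + C) := hD.isCompact.add hC.isCompact
  have hUfin : μ (D + interior C) ≠ ⊤ := ((measure_mono hsub).trans_lt hDC.measure_lt_top).ne
  have hUconv : Convex ℝ (D + interior C) := hD.convex.add hC.convex.interior
  have hcl : D + C ⊆ closure (D + interior C) := by
    have : C = closure (interior C) := by
      rw [hC.convex.closure_interior_eq_closure_of_nonempty_interior hC.nonempty_interior,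
        hC.isCompact.isClosed.closure_eq]
    calc D + C ⊆ closure D + closure (interior C) := by
          rw [← this]
          exact Set.add_subset_add_right subset_closure
      _ ⊆ _ := vadd_set_closure_subset D (interior C)
  have hvol : μ.real (D + C) ≤ μ.real (D + interior C) := by
    refine ENNReal.toReal_mono hUfin ((measure_mono hcl).trans ?_)
    rw [closure_eq_self_union_frontier]
    refine (measure_union_le _ _).trans ?_
    rw [hUconv.addHaar_frontier μ, add_zero]
  refine (mul_le_mul_of_nonneg_left hvol hA0.le).trans ?_
  by_contra! hlt
  have hlt' : ENNReal.ofReal (μ.real (A + C) * μ.real (A + D) / μ.real A) < μ (D + interior C) := by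
    rw [ENNReal.ofReal_lt_iff_lt_toReal (by positivity) hUfin, div_lt_iff₀ hA0, mul_comm _ (μ.real A)]
    exact hlt
  obtain ⟨K, hKU, hK, hKlt⟩ := hU.exists_lt_isCompact hlt'
  have hcover : K ⊆ ⋃ d : D, (fun y => (d : E) + y) '' interior C := by
    intro y hy
    obtain ⟨d, hd, x, hx, rfl⟩ := hKU hy
    exact Set.mem_iUnion.2 ⟨⟨d, hd⟩, x, hx, rfl⟩
  obtain ⟨T, hT⟩ := hK.elim_finite_subcover _
    (fun d : D => (Homeomorph.addLeft (d : E)).isOpenMap _ isOpen_interior) hcover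
  classical
  set F : Finset E := T.image Subtype.val with hF
  have hFD : (F : Set E) ⊆ D := by
    intro x hx
    simp only [hF, Finset.coe_image, Set.mem_image] at hx
    obtain ⟨d, -, rfl⟩ := hx
    exact d.2
  have hKF : K ⊆ C + F := by
    intro y hy
    obtain ⟨d, hd, x, hx, rfl⟩ := Set.mem_iUnion₂.1 (hT hy)
    rw [add_comm C]
    exact Set.add_mem_add (Finset.mem_coe.2 (Finset.mem_image_of_mem _ hd)) (interior_subset hx)
  have h1 := measureReal_mul_add_finset_le μ hA.isCompact hC.isCompact hA0 F
  have h2 : μ.real K ≤ μ.real (C + F) :=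
    measureReal_mono hKF (hC.isCompact.add F.finite_toSet.isCompact).measure_lt_top.ne
  have h3 : μ.real (A + F) ≤ μ.real (A + D) :=
    measureReal_mono (Set.add_subset_add_left hFD) (hA.isCompact.add hD.isCompact).measure_lt_top.ne
  have h4 : μ.real (A + C) * μ.real (A + D) / μ.real A < μ.real K :=
    (ENNReal.ofReal_lt_iff_lt_toReal (by positivity) hK.measure_lt_top.ne).1 hKlt
  rw [div_lt_iff₀ hA0] at h4
  have h5 : μ.real (A + C) * μ.real (A + F) ≤ μ.real (A + C) * μ.real (A + D) := by gcongr
  have h6 : μ.real A * μ.real K ≤ μ.real A * μ.real (C + F) := by gcongr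
  linarith

/-- Each use of `measureReal_mul_add_le` trades one B_i for a copy of A; convexity merges the copies
into a dilate. -/
theorem prod_measureReal_mul_add_sum_le {ι : Type*} {A D : Set E} {B : ι → Set E} (hA : IsSolid A)
    (hB : ∀ i, IsSolid (B i)) (hD : IsSolid D) (I : Finset ι) :
    (∏ _i ∈ I, μ.real A) * μ.real (D + ∑ i ∈ I, B i) ≤
      (∏ i ∈ I, μ.real (A + B i)) * μ.real (D + (I.card : ℝ) • A) := by
  classical
  induction I using Finset.induction_on generalizing D with
  | empty => simp [Set.zero_smul_set hA.nonempty]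
  | insert i I hi ih =>
    have h1 := measureReal_mul_add_le μ hA (hB i) (hD.add_sum hB I)
    have h2 := ih (hA.add hD)
    have h3 : A + D + (I.card : ℝ) • A = D + ((insert i I).card : ℝ) • A := by
      rw [Finset.card_insert_of_notMem hi, Nat.cast_add, hA.convex.add_smul (by positivity)
        (by positivity), Nat.cast_one, one_smul, add_comm A D, add_assoc, add_comm A]
    rw [h3] at h2
    have h4 : D + ∑ j ∈ insert i I, B j = D + ∑ j ∈ I, B j + B i := by
      rw [Finset.sum_insert hi, add_comm (B i), add_assoc]
    rw [Finset.prod_insert hi, Finset.prod_insert hi, h4]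
    rw [← add_assoc A D] at h1
    have hp : 0 ≤ ∏ _i ∈ I, μ.real A := Finset.prod_nonneg fun _ _ => measureReal_nonneg
    calc _ = (∏ _i ∈ I, μ.real A) * (μ.real A * μ.real (D + ∑ j ∈ I, B j + B i)) := by ring
      _ ≤ (∏ _i ∈ I, μ.real A) * (μ.real (A + B i) * μ.real (A + D + ∑ j ∈ I, B j)) := by gcongr
      _ = μ.real (A + B i) * ((∏ _i ∈ I, μ.real A) * μ.real (A + D + ∑ j ∈ I, B j)) := by ring
      _ ≤ μ.real (A + B i) * ((∏ i ∈ I, μ.real (A + B i)) *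
          μ.real (D + ((insert i I).card : ℝ) • A)) := by gcongr
      _ = _ := by ring

theorem measureReal_add_smul_le {A D : Set E} (hD : Convex ℝ D)
    (hD' : IsCompact D) {b : E} (hAD : b +ᵥ A ⊆ D) {r : ℝ} (hr : 0 ≤ r) :
    μ.real (D + r • A) ≤ (1 + r) ^ Module.finrank ℝ E * μ.real D := by
  -- Up to translation A lies in D, and D + rD = (1 + r)D by convexity.
  have h1 : (r • b) +ᵥ (D + r • A) ⊆ (1 + r) • D := by
    rw [hD.add_smul zero_le_one hr, one_smul]
    rintro _ ⟨_, ⟨d, hd, _, ⟨a, ha, rfl⟩, rfl⟩, rfl⟩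
    refine ⟨d, hd, r • (b + a), Set.smul_mem_smul_set (hAD ⟨a, ha, rfl⟩), ?_⟩
    simp only [vadd_eq_add, smul_add]
    abel
  have h2 : μ.real ((r • b) +ᵥ (D + r • A)) = μ.real (D + r • A) := by
    rw [measureReal_def, measureReal_def, measure_vadd]
  rw [← h2]
  refine (measureReal_mono h1 (hD'.smul (1 + r)).measure_lt_top.ne).trans_eq ?_
  rw [measureReal_def, Measure.addHaar_smul_of_nonneg μ (by positivity), ENNReal.toReal_mul,
    ENNReal.toReal_ofReal (by positivity), measureReal_def]

theorem log_measureReal_add_sum_union_le {ι : Type*} [DecidableEq ι] {A : Set E} {B : ι → Set E}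
    (hA : IsSolid A) (hB : ∀ i, IsSolid (B i)) {S T I : Finset ι} (hTS : T ⊆ S)
    (hIS : Disjoint S I) :
    Real.log (μ.real (A + ∑ i ∈ S ∪ I, B i)) ≤ Real.log (μ.real (A + ∑ i ∈ S, B i)) +
      ∑ i ∈ I, (Real.log (μ.real (A + ∑ j ∈ insert i T, B j)) -
        Real.log (μ.real (A + ∑ j ∈ T, B j))) +
      Module.finrank ℝ E * Real.log (1 + I.card) := by
  have hsol := hA.add_sum hB
  have hpos (J : Finset ι) : 0 < μ.real (A + ∑ i ∈ J, B i) := (hsol J).measureReal_pos μ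
  -- The base body is A + ∑_T B_i, so the ratios that appear are the marginals at T.
  have h1 := prod_measureReal_mul_add_sum_le μ (hsol T) hB (hsol S) I
  obtain ⟨b, hb⟩ : ∃ b : E, b +ᵥ (A + ∑ i ∈ T, B i) ⊆ A + ∑ i ∈ S, B i := by
    choose x hx using fun i => (hB i).nonempty
    refine ⟨∑ i ∈ S \ T, x i, ?_⟩
    rintro _ ⟨y, hy, rfl⟩
    rw [← Finset.sum_sdiff hTS, add_left_comm]
    exact Set.add_mem_add (Set.finsetSum_mem_finsetSum _ _ _ fun i _ => hx i) hy
  have h2 := measureReal_add_smul_le μ (hsol S).convex (hsol S).isCompact hb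
    (Nat.cast_nonneg I.card)
  have hins : ∏ i ∈ I, μ.real (A + ∑ j ∈ T, B j + B i) =
      ∏ i ∈ I, μ.real (A + ∑ j ∈ insert i T, B j) := by
    refine Finset.prod_congr rfl fun i hi => ?_
    have : i ∉ T := fun h => Finset.disjoint_left.1 hIS (hTS h) hi
    rw [Finset.sum_insert this, add_comm (B i), add_assoc]
  rw [hins, add_assoc A (∑ i ∈ S, B i) (∑ i ∈ I, B i),
    ← Finset.sum_union hIS] at h1
  have h3 := h1.trans (mul_le_mul_of_nonneg_left h2
    (Finset.prod_nonneg fun i _ => (hpos _).le))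
  have hP : 0 < ∏ i ∈ I, μ.real (A + ∑ j ∈ insert i T, B j) := Finset.prod_pos fun i _ => hpos _
  have hQ : 0 < ∏ _i ∈ I, μ.real (A + ∑ j ∈ T, B j) := Finset.prod_pos fun i _ => hpos _
  have h4 := Real.log_le_log (mul_pos hQ (hpos _)) h3
  rw [Real.log_mul hQ.ne' (hpos _).ne', Real.log_mul hP.ne' (by have := hpos S; positivity),
    Real.log_mul (by positivity) (hpos _).ne', Real.log_pow,
    Real.log_prod fun i _ => (hpos _).ne', Real.log_prod fun i _ => (hpos _).ne'] at h4
  rw [Finset.sum_sub_distrib]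
  linarith

end ConvexBodies

/-! ### Averaging over permutations. -/

section Averages

variable {α : Type*} [Fintype α] [DecidableEq α]

theorem sum_perm_map_eq_of_card_eq (F : Finset α → ℝ) {s t : Finset α} (h : s.card = t.card) :
    ∑ σ : Equiv.Perm α, F (s.map σ.toEmbedding) = ∑ σ : Equiv.Perm α, F (t.map σ.toEmbedding) := by
  set τ : Equiv.Perm α := (Finset.equivOfCardEq h).extendSubtype with hτ
  have hst : s.map τ.toEmbedding = t := by
    refine Finset.eq_of_subset_of_card_le ?_ (by rw [Finset.card_map, h])
    intro y hy
    obtain ⟨x, hx, rfl⟩ := Finset.mem_map.1 hy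
    exact (Finset.equivOfCardEq h).extendSubtype_mem x hx
  rw [← hst, ← Equiv.sum_comp (Equiv.mulRight τ)]
  refine Finset.sum_congr rfl fun σ _ => ?_
  rw [Finset.map_map]
  rfl

theorem choose_mul_sum_perm_map (F : Finset α → ℝ) (s : Finset α) :
    ((Fintype.card α).choose s.card : ℝ) * ∑ σ : Equiv.Perm α, F (s.map σ.toEmbedding) =
      (Fintype.card α).factorial * ∑ t ∈ Finset.powersetCard s.card Finset.univ, F t := by
  have h1 : ∑ t ∈ Finset.powersetCard s.card (Finset.univ : Finset α),
      ∑ σ : Equiv.Perm α, F (t.map σ.toEmbedding) =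
      ((Fintype.card α).choose s.card : ℝ) * ∑ σ : Equiv.Perm α, F (s.map σ.toEmbedding) := by
    rw [Finset.sum_congr rfl fun t ht => sum_perm_map_eq_of_card_eq F
      (Finset.mem_powersetCard.1 ht).2, Finset.sum_const, Finset.card_powersetCard,
      Finset.card_univ, nsmul_eq_mul]
  have h2 (σ : Equiv.Perm α) : ∑ t ∈ Finset.powersetCard s.card (Finset.univ : Finset α),
      F (t.map σ.toEmbedding) = ∑ t ∈ Finset.powersetCard s.card Finset.univ, F t := by
    conv_rhs => rw [← Finset.map_univ_equiv σ, Finset.powersetCard_map, Finset.sum_map]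
    rfl
  rw [← h1, Finset.sum_comm, Finset.sum_congr rfl fun σ _ => h2 σ, Finset.sum_const,
    Finset.card_univ, Fintype.card_perm, nsmul_eq_mul]

end Averages

theorem choose_mul_sub_le_sum_powersetCard {m k : ℕ} (hkm : k ≤ m) (F : Finset (Fin m) → ℝ)
    (c : ℝ) (hF : ∀ S T : Finset (Fin m), S.card = k → T ⊆ S →
      F Finset.univ ≤ F S + ∑ i ∈ Sᶜ, (F (insert i T) - F T) + c) :
    (k * m.choose k : ℝ) * (F Finset.univ - F ∅ - c) ≤
      m * ∑ s ∈ Finset.powersetCard k Finset.univ, (F s - F ∅) := by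
  set J : ℕ → Finset (Fin m) := fun j => Finset.univ.filter fun x => x.val < j with hJ
  have hJcard : ∀ j ≤ m, (J j).card = j := by
    intro j hj
    simp [hJ, Fin.card_filter_val_lt, hj]
  set g : ℕ → ℝ := fun j => ∑ σ : Equiv.Perm (Fin m), F ((J j).map σ.toEmbedding) with hg
  have hg0 : g 0 = m.factorial * F ∅ := by
    simp [hg, hJ, Fintype.card_perm]
  -- Average the hypothesis over σ, with S and T the images of the first k and first j indices;
  -- every inserted set then has size j + 1.
  have step : ∀ j ∈ Finset.range k,
      m.factorial * (F Finset.univ - c) - g k ≤ (m - k) * (g (j + 1) - g j) := by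
    intro j hj
    have hjk := Finset.mem_range.1 hj
    have hins : ∀ i ∈ (J k)ᶜ,
        ∑ σ : Equiv.Perm (Fin m), F ((insert i (J j)).map σ.toEmbedding) = g (j + 1) := by
      intro i hi
      refine sum_perm_map_eq_of_card_eq F ?_
      rw [Finset.card_insert_of_notMem, hJcard j (by omega), hJcard (j + 1) (by omega)]
      simp only [hJ, Finset.mem_compl, Finset.mem_filter, Finset.mem_univ, true_and] at hi ⊢
      omega
    have hσ : ∀ σ : Equiv.Perm (Fin m), F Finset.univ ≤ F ((J k).map σ.toEmbedding) +
        ∑ i ∈ (J k)ᶜ, (F ((insert i (J j)).map σ.toEmbedding) - F ((J j).map σ.toEmbedding)) +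
        c := by
      intro σ
      have hsub : J j ⊆ J k := by
        intro x hx
        simp only [hJ, Finset.mem_filter, Finset.mem_univ, true_and] at hx ⊢
        omega
      refine (hF ((J k).map σ.toEmbedding) ((J j).map σ.toEmbedding)
        (by rw [Finset.card_map, hJcard k hkm]) (Finset.map_subset_map.2 hsub)).trans_eq ?_
      have : ((J k).map σ.toEmbedding)ᶜ = ((J k)ᶜ).map σ.toEmbedding := by
        ext x
        simp
      rw [this, Finset.sum_map]
      simp only [Finset.map_insert]
    have hsum := Finset.sum_le_sum fun σ (_ : σ ∈ (Finset.univ : Finset (Equiv.Perm (Fin m)))) => hσ σ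
    rw [Finset.sum_add_distrib, Finset.sum_add_distrib, Finset.sum_comm] at hsum
    simp only [Finset.sum_sub_distrib] at hsum
    rw [Finset.sum_congr rfl hins] at hsum
    simp only [Finset.sum_const, Finset.card_univ, Fintype.card_perm, Fintype.card_fin,
      Finset.card_compl, hJcard k hkm, nsmul_eq_mul, Nat.cast_sub hkm] at hsum
    simp only [hg] at hsum ⊢
    linarith
  have tele := Finset.sum_le_sum step
  rw [Finset.sum_const, Finset.card_range, nsmul_eq_mul, ← Finset.mul_sum,
    Finset.sum_range_sub, hg0] at tele
  have havg := choose_mul_sum_perm_map F (J k)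
  rw [hJcard k hkm, Fintype.card_fin] at havg
  change (m.choose k : ℝ) * g k = _ at havg
  have hfac : (0 : ℝ) < m.factorial := by exact_mod_cast m.factorial_pos
  have hch : (0 : ℝ) ≤ m.choose k := by positivity
  rw [Finset.sum_sub_distrib, Finset.sum_const, Finset.card_powersetCard, Finset.card_univ,
    Fintype.card_fin, nsmul_eq_mul]
  refine le_of_mul_le_mul_left ?_ hfac
  have := mul_le_mul_of_nonneg_left tele hch
  linear_combination this + m * havg

/-! ### Conclusion: from log volumes to the stated bound. -/

theorem corollary7 (n m k : ℕ) (hn : 1 ≤ n) (hk : 1 ≤ k) (hkm : k ≤ m)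
    (A : ConvexBody (EuclideanSpace ℝ (Fin n)))
    (B : Fin m → ConvexBody (EuclideanSpace ℝ (Fin n)))
    (hA : (interior (A : Set (EuclideanSpace ℝ (Fin n)))).Nonempty)
    (hB : ∀ i, (interior (B i : Set (EuclideanSpace ℝ (Fin n)))).Nonempty)
    (c : Finset (Fin m) → ℝ)
    (hc : ∀ s ∈ Finset.powersetCard k (Finset.univ : Finset (Fin m)),
      (volume ((A : Set (EuclideanSpace ℝ (Fin n))) +
          ∑ i ∈ s, (B i : Set (EuclideanSpace ℝ (Fin n))))).toReal ^ (1 / (n : ℝ)) ≤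
        c s * (volume (A : Set (EuclideanSpace ℝ (Fin n)))).toReal ^ (1 / (n : ℝ))) :
    (volume ((A : Set (EuclideanSpace ℝ (Fin n))) +
        ∑ i, (B i : Set (EuclideanSpace ℝ (Fin n))))).toReal ^ (1 / (n : ℝ)) ≤
      (1 + (m : ℝ)) *
        (∏ s ∈ Finset.powersetCard k (Finset.univ : Finset (Fin m)), c s) ^
          (1 / ((m - 1).choose (k - 1) : ℝ)) *
        (volume (A : Set (EuclideanSpace ℝ (Fin n)))).toReal ^ (1 / (n : ℝ)) := by
  have hAs : IsSolid (A : Set (EuclideanSpace ℝ (Fin n))) := ⟨A.convex, A.isCompact, hA⟩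
  have hBs (i) : IsSolid (B i : Set (EuclideanSpace ℝ (Fin n))) :=
    ⟨(B i).convex, (B i).isCompact, hB i⟩
  set V : Finset (Fin m) → ℝ := fun s => (volume ((A : Set (EuclideanSpace ℝ (Fin n))) +
    ∑ i ∈ s, (B i : Set (EuclideanSpace ℝ (Fin n))))).toReal with hV
  have hVpos (s) : 0 < V s := (hAs.add_sum hBs s).measureReal_pos volume
  have hVA : (volume (A : Set (EuclideanSpace ℝ (Fin n)))).toReal = V ∅ := by simp [hV]
  rw [hVA] at hc ⊢
  change V Finset.univ ^ (1 / (n : ℝ)) ≤ _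
  replace hc : ∀ s ∈ Finset.powersetCard k (Finset.univ : Finset (Fin m)),
    V s ^ (1 / (n : ℝ)) ≤ c s * V ∅ ^ (1 / (n : ℝ)) := hc
  have hn0 : (0 : ℝ) < n := by exact_mod_cast hn
  have hk0 : (0 : ℝ) < k := by exact_mod_cast hk
  have hm0 : (0 : ℝ) < m := by exact_mod_cast hk.trans hkm
  have hr (s) : 0 < V s ^ (1 / (n : ℝ)) := Real.rpow_pos_of_pos (hVpos s) _
  have hcpos : ∀ s ∈ Finset.powersetCard k (Finset.univ : Finset (Fin m)), 0 < c s := fun s hs =>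
    pos_of_mul_pos_left ((hr s).trans_le (hc s hs)) (hr ∅).le
  have hclog : ∀ s ∈ Finset.powersetCard k (Finset.univ : Finset (Fin m)),
      Real.log (V s) - Real.log (V ∅) ≤ n * Real.log (c s) := by
    intro s hs
    have h := Real.log_le_log (hr s) (hc s hs)
    rw [Real.log_mul (hcpos s hs).ne' (hr ∅).ne', Real.log_rpow (hVpos s),
      Real.log_rpow (hVpos ∅)] at h
    have h' := mul_le_mul_of_nonneg_left h hn0.le
    field_simp at h'
    linarith
  have hsub : ∀ S T : Finset (Fin m), S.card = k → T ⊆ S →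
      Real.log (V Finset.univ) ≤ Real.log (V S) +
        ∑ i ∈ Sᶜ, (Real.log (V (insert i T)) - Real.log (V T)) + n * Real.log (1 + m) := by
    intro S T _ hTS
    have h := log_measureReal_add_sum_union_le volume hAs hBs hTS
      (disjoint_compl_right : Disjoint S Sᶜ)
    rw [Finset.union_compl, finrank_euclideanSpace_fin] at h
    refine h.trans ?_
    have hcard : ((Sᶜ.card : ℕ) : ℝ) ≤ m := by
      exact_mod_cast (Finset.card_le_univ Sᶜ).trans_eq (Fintype.card_fin m)
    have hlog : Real.log (1 + (Sᶜ.card : ℝ)) ≤ Real.log (1 + m) :=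
      Real.log_le_log (by positivity) (by linarith)
    exact add_le_add le_rfl (mul_le_mul_of_nonneg_left hlog hn0.le)
  have main := choose_mul_sub_le_sum_powersetCard hkm (fun s => Real.log (V s)) _ hsub
  set N : ℝ := ((m - 1).choose (k - 1) : ℝ) with hN
  have hN0 : 0 < N := by
    rw [hN]
    exact_mod_cast Nat.choose_pos (Nat.sub_le_sub_right hkm 1)
  -- This identity turns the averaging weights into the exponent 1 / N.
  have hkN : (k * m.choose k : ℝ) = m * N := by
    obtain ⟨m, rfl⟩ := Nat.exists_eq_add_of_le' (hk.trans hkm)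
    obtain ⟨k, rfl⟩ := Nat.exists_eq_add_of_le' hk
    rw [hN, Nat.add_sub_cancel, Nat.add_sub_cancel, mul_comm]
    exact_mod_cast (Nat.add_one_mul_choose_eq m k).symm
  set P : ℝ := ∏ s ∈ Finset.powersetCard k (Finset.univ : Finset (Fin m)), c s with hP
  have hP0 : 0 < P := Finset.prod_pos hcpos
  have hlogP : ∑ s ∈ Finset.powersetCard k (Finset.univ : Finset (Fin m)),
      (Real.log (V s) - Real.log (V ∅)) ≤ n * Real.log P := by
    rw [hP, Real.log_prod fun s hs => (hcpos s hs).ne', Finset.mul_sum]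
    exact Finset.sum_le_sum hclog
  rw [hkN, mul_assoc] at main
  have main' := (le_of_mul_le_mul_left main hm0).trans hlogP
  have hPr : 0 < P ^ (1 / N) := Real.rpow_pos_of_pos hP0 _
  have h1m : (0 : ℝ) < 1 + m := by positivity
  rw [← Real.log_le_log_iff (hr _) (mul_pos (mul_pos h1m hPr) (hr _)),
    Real.log_mul (mul_pos h1m hPr).ne' (hr _).ne', Real.log_mul h1m.ne' hPr.ne',
    Real.log_rpow (hVpos _), Real.log_rpow (hVpos _), Real.log_rpow hP0]
  have hdiv : Real.log (V Finset.univ) - Real.log (V ∅) - n * Real.log (1 + m) ≤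
      n * Real.log P / N := by
    rw [le_div_iff₀ hN0, mul_comm]
    exact main'
  have hfin := mul_le_mul_of_nonneg_left hdiv (one_div_pos.2 hn0).le
  have e1 : 1 / (n : ℝ) * (n * Real.log P / N) = 1 / N * Real.log P := by field_simp
  have e2 : 1 / (n : ℝ) * (Real.log (V Finset.univ) - Real.log (V ∅) - n * Real.log (1 + m)) =
      1 / n * Real.log (V Finset.univ) - 1 / n * Real.log (V ∅) - Real.log (1 + m) := by
    field_simp
  rw [e1, e2] at hfin
  linarith
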